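/- Let $n\ge 1$, let $\Omega\subset\mathbb{R}^n$ be a non-empty, open and bounded set and let $1<p<\infty$. For a function $V:\mathbb{R}\times\mathbb{R}\to\mathbb{R}$ and $u\in L^p(\Omega)$ put $$I_V(u)=\int_\Omega\int_\Omega V(u(x),u(y))\,dx\,dy ,\qquad I_V^{\rm rlx}(u)=\inf\Bigl\{\liminf_{j\to\infty} I_V(u_j)\;:\; u_j\rightharpoonup u\text{ weakly in }L^p(\Omega)\Bigr\},$$ with values in $[-\infty,\infty]$. Say that $V$ is symmetric if $V(\xi,\zeta)=V(\zeta,\xi)$ for all $\xi,\zeta$, that $V$ has $p$-growth if there is $C>0$ with $V(\xi,\zeta)\le C(|\xi|^p+|\zeta|^p+1)$ for all $\xi,\zeta$, and that $V$ is separately convex if $V(\cdot,\xi)$ and $V(\xi,\cdot)$ are convex for every $\xi\in\mathbb{R}$; let $V^{\rm sc}$ denote the largest separately convex function below $V$. Let $K=\{(\xi,\zeta)\in\mathbb{R}\times\mathbb{R}: |\xi|+|\zeta|=1\}$ be the boundary of the closed unit ball of the $1$-norm $\|(\xi,\zeta)\|_1=|\xi|+|\zeta|$, and let $$W(\xi,\zeta)=\Bigl(\min_{(\alpha,\beta)\in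 K}\|(\xi,\zeta)-(\alpha,\beta)\|_1\Bigr)^p\qquad\text{for }(\xi,\zeta)\in\mathbb{R}\times\mathbb{R}.$$ Then there is no symmetric, lower semicontinuous function $G:\mathbb{R}\times\mathbb{R}\to\mathbb{R}$ with $p$-growth such that $I_W^{\rm rlx}(u)=I_G(u)$ for all $u\in L^p(\Omega)$. Moreover, for every Lebesgue measurable set $\Omega_1\subset\Omega$ with $|\Omega_1|>0$ and $|\Omega\setminus\Omega_1|>0$ (where $|\cdot|$ is Lebesgue measure and $\mathbf{1}_{\Omega_1}$ is the characteristic function of $\Omega_1$), one has $I_W^{\rm rlx}(\mathbf{1}_{\Omega_1})\ne I_{W^{\rm sc}}(\mathbf{1}_{\Omega_1})$. -/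

import Mathlib

open MeasureTheory Filter Topology
open scoped ENNReal

noncomputable section

namespace DoubleIntegral

/-- The double-integral functional `I_W(u) = ∫_Ω ∫_Ω W(u(x), u(y)) dx dy`, with values in the
extended reals: the integral of the positive part minus the integral of the negative part. For
`u ∈ L^p(Ω)` and `W` of `p`-growth from above the first of them is finite (`Ω` being bounded). -/
def functional {n : ℕ} (Ω : Set (EuclideanSpace ℝ (Fin n))) (W : ℝ × ℝ → ℝ)
    (u : EuclideanSpace ℝ (Fin n) → ℝ) : EReal :=
  ((∫⁻ y in Ω, ∫⁻ x in Ω, ENNReal.ofReal (W (u x, u y)) : ℝ≥0∞) : EReal) -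
    ((∫⁻ y in Ω, ∫⁻ x in Ω, ENNReal.ofReal (-W (u x, u y)) : ℝ≥0∞) : EReal)

/-- `u ∈ L^p(Ω)`, for a representative `u` (whose values outside `Ω` are irrelevant). -/
def InLp {n : ℕ} (p : ℝ) (Ω : Set (EuclideanSpace ℝ (Fin n)))
    (u : EuclideanSpace ℝ (Fin n) → ℝ) : Prop :=
  MemLp u (ENNReal.ofReal p) (volume.restrict Ω)

/-- Weak convergence `u_j ⇀ u` in `L^p(Ω)`, `1 < p < ∞`: convergence of `∫_Ω u_j g` to `∫_Ω u g`
for every `g` in the dual space `L^{p'}(Ω)`, where `p' = p / (p - 1)`. -/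
def WeaklyConverges {n : ℕ} (p : ℝ) (Ω : Set (EuclideanSpace ℝ (Fin n)))
    (v : ℕ → EuclideanSpace ℝ (Fin n) → ℝ) (u : EuclideanSpace ℝ (Fin n) → ℝ) : Prop :=
  ∀ g : EuclideanSpace ℝ (Fin n) → ℝ, InLp (p / (p - 1)) Ω g →
    Tendsto (fun j => ∫ x in Ω, v j x * g x) atTop (𝓝 (∫ x in Ω, u x * g x))

/-- The relaxation
`I_W^rlx(u) = inf { liminf_j I_W(u_j) : u_j ∈ L^p(Ω), u_j ⇀ u in L^p(Ω) }`. -/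
def relaxation {n : ℕ} (p : ℝ) (Ω : Set (EuclideanSpace ℝ (Fin n))) (W : ℝ × ℝ → ℝ)
    (u : EuclideanSpace ℝ (Fin n) → ℝ) : EReal :=
  sInf {l : EReal | ∃ v : ℕ → EuclideanSpace ℝ (Fin n) → ℝ,
    (∀ j, InLp p Ω (v j)) ∧ WeaklyConverges p Ω v u ∧
      l = liminf (fun j => functional Ω W (v j)) atTop}

/-- Symmetry of an integrand. -/
def IsSymm (W : ℝ × ℝ → ℝ) : Prop :=
  ∀ ξ ζ : ℝ, W (ξ, ζ) = W (ζ, ξ)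

/-- `p`-growth (from above) of an integrand. -/
def HasGrowth (p : ℝ) (W : ℝ × ℝ → ℝ) : Prop :=
  ∃ C : ℝ, 0 < C ∧ ∀ ξ ζ : ℝ, W (ξ, ζ) ≤ C * (|ξ| ^ p + |ζ| ^ p + 1)

/-- Separate convexity: convexity in each variable with the other one fixed. -/
def SeparatelyConvex (W : ℝ × ℝ → ℝ) : Prop :=
  ∀ ξ : ℝ, ConvexOn ℝ Set.univ (fun t => W (t, ξ)) ∧ ConvexOn ℝ Set.univ (fun t => W (ξ, t))

/-- The separately convex envelope `W^sc`: the pointwise supremum of the separately convex functions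
below `W`, that is, the largest of them (if there is one at all, as for every `W ≥ 0`). -/
def scEnvelope (W : ℝ × ℝ → ℝ) (z : ℝ × ℝ) : ℝ :=
  sSup {r : ℝ | ∃ V : ℝ × ℝ → ℝ, SeparatelyConvex V ∧ (∀ w, V w ≤ W w) ∧ r = V z}

/-- The distance of a point to a set for the `1`-norm `‖(ξ, ζ)‖₁ = |ξ| + |ζ|`. -/
def dist₁ (z : ℝ × ℝ) (K : Set (ℝ × ℝ)) : ℝ :=
  Metric.infDist (WithLp.toLp 1 z) (WithLp.toLp 1 '' K)

/-- The boundary of the closed unit ball of the `1`-norm in `ℝ × ℝ`. -/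
def sphere₁ : Set (ℝ × ℝ) :=
  {z : ℝ × ℝ | |z.1| + |z.2| = 1}

/-- The integrand `W = dist₁(·, K) ^ p` with `K` the boundary of the unit ball of the `1`-norm. -/
def integrand (p : ℝ) (z : ℝ × ℝ) : ℝ :=
  dist₁ z sphere₁ ^ p

end DoubleIntegral

end

namespace DoubleIntegral

/-! The distance to `sphere₁` is explicit, so the integrand is `||ξ| + |ζ| - 1| ^ p`: a convex
function of `|ξ| + |ζ|`. Put `a = |Ω₁|`, `b = |Ω \ Ω₁|`, and let `v j ⇀ 1_{Ω₁}`. Jensen on the four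
blocks (`block_lower_bound`) bounds the functional below by `a²|2m₁ - 1|^p + 2ab|m₁ + m₀ - 1|^p +
b²|2m₀ - 1|^p`, where `m₁`, `m₀` are the averages of `|v j|`. Weak convergence forces `m₁ ≥ 1 -
o(1)`, so the first term is at least `a² - o(1)`. The other two cannot both be small: the first of
them needs `m₀` near `0`, the second `m₀` near `1/2`. Hence the relaxation is at least `a² + δ`,
with `δ > 0` if `a, b > 0` (`relaxation_indicator_lower_bound`).

The separately convex envelope is at most `1` at `(1, 1)` and at most `0` at `(1, 0)`, `(0, 1)`,
`(0, 0)`, so its functional is at most `a²`, which settles the second claim.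

For the first claim, suppose `G` represents the relaxation. Oscillation between `±1/2` gives `G (0,
0) ≤ 0`, the constant `1` gives `G (1, 1) = 1`, and the gap `δ` then forces `g = G (1, 0) + G (0, 1)
> 0`. But the relaxation is at most the original functional `a² + b²`, so `ab g ≤ b² (1 - G (0,
0))`. The left side is of first order in `b` and the right side of second order, which is impossible
for small `b`. -/

/-! ### Explicit form of the integrand -/

theorem integrand_eq (p : ℝ) (z : ℝ × ℝ) : integrand p z = |(|z.1| + |z.2| - 1)| ^ p := by
  have key : dist₁ z sphere₁ = |(|z.1| + |z.2| - 1)| := by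
    unfold dist₁
    have hne : (WithLp.toLp 1 '' sphere₁ : Set (WithLp 1 (ℝ × ℝ))).Nonempty :=
      ⟨_, (1, 0), by simp [sphere₁], rfl⟩
    apply le_antisymm
    -- The radial projection onto the sphere realises the distance; it is undefined at the origin,
    -- where any point of the sphere serves.
    · by_cases hz : |z.1| + |z.2| = 0
      · have h1 : z.1 = 0 := abs_eq_zero.1 (by linarith [abs_nonneg z.1, abs_nonneg z.2])
        have h2 : z.2 = 0 := abs_eq_zero.1 (by linarith [abs_nonneg z.1, abs_nonneg z.2])
        refine (Metric.infDist_le_dist_of_mem (y := WithLp.toLp 1 (1, 0))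
          (Set.mem_image_of_mem _ (show ((1 : ℝ), (0 : ℝ)) ∈ sphere₁ by simp [sphere₁]))).trans ?_
        rw [WithLp.prod_dist_eq_of_L1]
        simp [h1, h2]
      · set s := |z.1| + |z.2| with hs
        have hs0 : 0 < s := lt_of_le_of_ne (by positivity) (Ne.symm hz)
        have hmem : (z.1 / s, z.2 / s) ∈ sphere₁ := by
          change |z.1 / s| + |z.2 / s| = 1
          rw [abs_div, abs_div, abs_of_pos hs0, ← add_div, ← hs, div_self hz]
        refine (Metric.infDist_le_dist_of_mem (Set.mem_image_of_mem (WithLp.toLp 1) hmem)).trans ?_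
        · rw [WithLp.prod_dist_eq_of_L1]
          change |z.1 - z.1 / s| + |z.2 - z.2 / s| ≤ |s - 1|
          have h (t : ℝ) : |t - t / s| = |t| * (|s - 1| / s) := by
            rw [show t - t / s = t * ((s - 1) / s) by field_simp, abs_mul, abs_div, abs_of_pos hs0]
          rw [h, h, ← add_mul, ← hs]
          apply le_of_eq
          field_simp
    · rw [Metric.le_infDist hne]
      rintro _ ⟨w, hw, rfl⟩
      rw [WithLp.prod_dist_eq_of_L1]
      change |w.1| + |w.2| = 1 at hw
      change |(|z.1| + |z.2| - 1)| ≤ |z.1 - w.1| + |z.2 - w.2|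
      have h1 := abs_abs_sub_abs_le_abs_sub z.1 w.1
      have h2 := abs_abs_sub_abs_le_abs_sub z.2 w.2
      rw [abs_le] at h1 h2 ⊢
      constructor <;> linarith [h1.1, h1.2, h2.1, h2.2]
  rw [integrand, key]

theorem integrand_nonneg (p : ℝ) (z : ℝ × ℝ) : 0 ≤ integrand p z := by
  rw [integrand_eq]; positivity

/-! ### Jensen's inequality -/

theorem convexOn_abs_rpow {p : ℝ} (hp : 1 ≤ p) :
    ConvexOn ℝ Set.univ (fun t : ℝ => |t| ^ p) := by
  refine ⟨convex_univ, fun x _ y _ a b ha hb hab => ?_⟩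
  calc |a • x + b • y| ^ p ≤ (a • |x| + b • |y|) ^ p := by
        refine Real.rpow_le_rpow (abs_nonneg _) ((abs_add_le _ _).trans ?_) (by linarith)
        simp [abs_mul, abs_of_nonneg ha, abs_of_nonneg hb]
    _ ≤ a • |x| ^ p + b • |y| ^ p :=
        (convexOn_rpow hp).2 (abs_nonneg x) (abs_nonneg y) ha hb hab

/-- Jensen's inequality for `|·| ^ p` on a finite measure space. -/
theorem ofReal_mul_average_rpow_le {α : Type*} [MeasurableSpace α] {μ : Measure α}
    [IsFiniteMeasure μ] {p : ℝ} (hp : 1 ≤ p) {f : α → ℝ} (hf : MemLp f (ENNReal.ofReal p) μ) :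
    ENNReal.ofReal (μ.real Set.univ * |⨍ x, f x ∂μ| ^ p) ≤
      ∫⁻ x, ENNReal.ofReal (|f x| ^ p) ∂μ := by
  rcases eq_or_ne μ 0 with rfl | hμ
  · simp
  have : NeZero μ := ⟨hμ⟩
  have hp0 : 0 < p := by linarith
  have hint : Integrable (fun x => |f x| ^ p) μ := by
    have := hf.integrable_norm_rpow (by simpa using hp0) (by simp)
    simpa [ENNReal.toReal_ofReal hp0.le] using this
  have hf1 : Integrable f μ :=
    memLp_one_iff_integrable.1 (hf.mono_exponent (by simpa using hp))
  rw [← ofReal_integral_eq_lintegral_ofReal hint (ae_of_all _ fun x => by positivity)]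
  apply ENNReal.ofReal_le_ofReal
  have hc : Continuous fun t : ℝ => |t| ^ p :=
    continuous_abs.rpow_const fun _ => Or.inr hp0.le
  have := (convexOn_abs_rpow hp).map_average_le hc.continuousOn isClosed_univ
    (ae_of_all _ fun _ => Set.mem_univ _) hf1 hint
  calc μ.real Set.univ * |⨍ x, f x ∂μ| ^ p ≤ μ.real Set.univ * ⨍ x, |f x| ^ p ∂μ := by gcongr
    _ = ∫ x, |f x| ^ p ∂μ := by rw [← smul_eq_mul, measure_smul_average]

/-- Jensen's inequality in both variables for the double integral of `integrand p`. -/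
theorem ofReal_le_lintegral_lintegral_integrand {α : Type*} [MeasurableSpace α]
    {μ ν : Measure α} [IsFiniteMeasure μ] [IsFiniteMeasure ν] {p : ℝ} (hp : 1 ≤ p) {u : α → ℝ}
    (hμ : MemLp u (ENNReal.ofReal p) μ) (hν : MemLp u (ENNReal.ofReal p) ν) :
    ENNReal.ofReal (μ.real Set.univ * ν.real Set.univ *
        |(⨍ x, |u x| ∂μ) + (⨍ y, |u y| ∂ν) - 1| ^ p) ≤
      ∫⁻ y, ∫⁻ x, ENNReal.ofReal (integrand p (u x, u y)) ∂μ ∂ν := by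
  rcases eq_or_ne μ 0 with rfl | hμ0
  · simp
  rcases eq_or_ne ν 0 with rfl | hν0
  · simp
  have : NeZero μ := ⟨hμ0⟩
  have : NeZero ν := ⟨hν0⟩
  have avg {κ : Measure α} [IsFiniteMeasure κ] [NeZero κ] (hκ : MemLp u (ENNReal.ofReal p) κ)
      (c : ℝ) : ⨍ x, (|u x| + c) ∂κ = (⨍ x, |u x| ∂κ) + c := by
    have h1 : Integrable (fun x => |u x|) κ :=
      (memLp_one_iff_integrable.1 (hκ.mono_exponent (by simpa using hp))).abs
    rw [average_eq, average_eq, integral_add h1 (integrable_const c), smul_add]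
    congr 1
    rw [integral_const, smul_smul, inv_mul_cancel₀, one_smul]
    exact (measureReal_univ_pos (μ := κ)).ne'
  have mem {κ : Measure α} [IsFiniteMeasure κ] (hκ : MemLp u (ENNReal.ofReal p) κ) (c : ℝ) :
      MemLp (fun x => |u x| + c) (ENNReal.ofReal p) κ := hκ.abs.add (memLp_const c)
  set m := ⨍ x, |u x| ∂μ with hm
  -- For fixed `y` the integrand is `|·| ^ p` of `|u x|` plus a constant, so Jensen replaces `|u x|`
  -- by its average `m`; the result has the same form in `|u y|`.
  have inner (y : α) : ENNReal.ofReal (μ.real Set.univ) * ENNReal.ofReal (|(|u y| + (m - 1))| ^ p) ≤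
      ∫⁻ x, ENNReal.ofReal (integrand p (u x, u y)) ∂μ := by
    have := ofReal_mul_average_rpow_le hp (mem hμ (|u y| - 1))
    rw [avg hμ, ← hm] at this
    rw [← ENNReal.ofReal_mul measureReal_nonneg]
    have e (x : α) : integrand p (u x, u y) = |(|u x| + (|u y| - 1))| ^ p := by
      rw [integrand_eq, add_sub_assoc]
    simp only [e]
    rwa [show |u y| + (m - 1) = m + (|u y| - 1) by ring]
  refine le_trans ?_ (lintegral_mono inner)
  rw [lintegral_const_mul' _ _ ENNReal.ofReal_ne_top, mul_assoc,
    ENNReal.ofReal_mul measureReal_nonneg]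
  gcongr
  have := ofReal_mul_average_rpow_le hp (mem hν (m - 1))
  rw [avg hν] at this
  rwa [show m + (⨍ y, |u y| ∂ν) - 1 = (⨍ y, |u y| ∂ν) + (m - 1) by ring]

variable {n : ℕ}

/-! ### Lower bound for the relaxation at characteristic functions -/

theorem functional_of_nonneg (Ω : Set (EuclideanSpace ℝ (Fin n))) {W : ℝ × ℝ → ℝ}
    (hW : ∀ z, 0 ≤ W z) (u : EuclideanSpace ℝ (Fin n) → ℝ) :
    functional Ω W u =
      ((∫⁻ y in Ω, ∫⁻ x in Ω, ENNReal.ofReal (W (u x, u y)) : ℝ≥0∞) : EReal) := by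
  simp [functional, ENNReal.ofReal_of_nonpos, hW]

theorem restrict_add_restrict_sdiff {Ω Ω₁ : Set (EuclideanSpace ℝ (Fin n))} (hsub : Ω₁ ⊆ Ω)
    (hmeas : NullMeasurableSet Ω₁ volume) :
    volume.restrict Ω = volume.restrict Ω₁ + volume.restrict (Ω \ Ω₁) := by
  rw [← Measure.restrict_inter_add_sdiff₀ Ω hmeas, Set.inter_eq_self_of_subset_right hsub]

/-- Lower bound of the double integral by the four blocks of a partition of the domain. -/
theorem block_lower_bound {Ω Ω₁ : Set (EuclideanSpace ℝ (Fin n))} (hsub : Ω₁ ⊆ Ω)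
    (hmeas : NullMeasurableSet Ω₁ volume) (hfin : volume Ω ≠ ∞) {p : ℝ} (hp : 1 ≤ p)
    {u : EuclideanSpace ℝ (Fin n) → ℝ} (hu : InLp p Ω u) :
    ∃ m₁ m₀ : ℝ, |∫ x in Ω₁, u x| ≤ volume.real Ω₁ * m₁ ∧ 0 ≤ m₀ ∧
      (((volume.real Ω₁) ^ 2 * |2 * m₁ - 1| ^ p +
        2 * (volume.real Ω₁ * volume.real (Ω \ Ω₁)) * |m₁ + m₀ - 1| ^ p +
        (volume.real (Ω \ Ω₁)) ^ 2 * |2 * m₀ - 1| ^ p : ℝ) : EReal) ≤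
        functional Ω (integrand p) u := by
  have hf₁ : IsFiniteMeasure (volume.restrict Ω₁) :=
    isFiniteMeasure_restrict.2 (measure_ne_top_of_subset hsub hfin)
  have hf₀ : IsFiniteMeasure (volume.restrict (Ω \ Ω₁)) :=
    isFiniteMeasure_restrict.2 (measure_ne_top_of_subset Set.sdiff_subset hfin)
  have hu₁ : MemLp u (ENNReal.ofReal p) (volume.restrict Ω₁) :=
    hu.mono_measure (Measure.restrict_mono hsub le_rfl)
  have hu₀ : MemLp u (ENNReal.ofReal p) (volume.restrict (Ω \ Ω₁)) :=
    hu.mono_measure (Measure.restrict_mono Set.sdiff_subset le_rfl)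
  refine ⟨⨍ x in Ω₁, |u x|, ⨍ x in Ω \ Ω₁, |u x|, ?_, ?_, ?_⟩
  · have := measure_smul_setAverage (μ := volume) (fun x => |u x|)
      (measure_ne_top_of_subset hsub hfin)
    rw [smul_eq_mul] at this
    rw [this]
    exact abs_integral_le_integral_abs
  · rw [setAverage_eq]
    exact mul_nonneg (by positivity) (integral_nonneg fun _ => abs_nonneg _)
  rw [functional_of_nonneg Ω (integrand_nonneg p), restrict_add_restrict_sdiff hsub hmeas,
    lintegral_add_measure]
  simp only [lintegral_add_measure]
  have h11 := ofReal_le_lintegral_lintegral_integrand hp hu₁ hu₁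
  have h10 := ofReal_le_lintegral_lintegral_integrand hp hu₁ hu₀
  have h01 := ofReal_le_lintegral_lintegral_integrand hp hu₀ hu₁
  have h00 := ofReal_le_lintegral_lintegral_integrand hp hu₀ hu₀
  simp only [measureReal_restrict_apply_univ] at h11 h10 h01 h00
  -- Superadditivity of the lower Lebesgue integral is enough here, and it holds without
  -- measurability of the inner integrals in `y`.
  have key := add_le_add ((add_le_add h11 h01).trans (le_lintegral_add _ _))
    ((add_le_add h10 h00).trans (le_lintegral_add _ _))
  rw [← ENNReal.ofReal_add (by positivity) (by positivity),
    ← ENNReal.ofReal_add (by positivity) (by positivity),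
    ← ENNReal.ofReal_add (by positivity) (by positivity)] at key
  refine le_trans ?_ (EReal.coe_ennreal_le_coe_ennreal_iff.2 key)
  rw [EReal.coe_ennreal_ofReal, max_eq_left (by positivity)]
  apply le_of_eq
  congr 1
  rw [two_mul (⨍ x in Ω₁, |u x|), two_mul (⨍ x in Ω \ Ω₁, |u x|),
    add_comm (⨍ x in Ω \ Ω₁, |u x|) (⨍ x in Ω₁, |u x|)]
  ring

theorem inLp_indicator_one {Ω Ω₁ : Set (EuclideanSpace ℝ (Fin n))}
    (hmeas : NullMeasurableSet Ω₁ volume) (hfin : volume Ω ≠ ∞) (q : ℝ) :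
    InLp q Ω (Ω₁.indicator 1) := by
  have : IsFiniteMeasure (volume.restrict Ω) := isFiniteMeasure_restrict.2 hfin
  have h : MemLp (fun _ : EuclideanSpace ℝ (Fin n) => (1 : ℝ)) ∞ (volume.restrict Ω) :=
    memLp_const 1
  refine MemLp.mono_exponent (q := ∞) ?_ le_top
  refine h.mono ?_ (ae_of_all _ fun x => ?_)
  · exact (aestronglyMeasurable_const (b := (1 : ℝ))).indicator₀
      (hmeas.mono_ac Measure.restrict_le_self.absolutelyContinuous)
  · by_cases hx : x ∈ Ω₁ <;> simp [hx]

/-- The gap between the relaxation and the Jensen bound `|Ω₁|²` at a characteristic function. -/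
theorem relaxation_indicator_lower_bound {Ω Ω₁ : Set (EuclideanSpace ℝ (Fin n))} (hsub : Ω₁ ⊆ Ω)
    (hmeas : NullMeasurableSet Ω₁ volume) (hfin : volume Ω ≠ ∞) {p : ℝ} (hp : 1 < p)
    (hpos : 0 < volume Ω₁) :
    (((volume.real Ω₁) ^ 2 + min ((volume.real (Ω \ Ω₁)) ^ 2)
      (2 * (volume.real Ω₁ * volume.real (Ω \ Ω₁))) * (1 / 4) ^ p : ℝ) : EReal) ≤
      relaxation p Ω (integrand p) (Ω₁.indicator 1) := by
  set a := volume.real Ω₁ with ha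
  set b := volume.real (Ω \ Ω₁) with hb
  have ha0 : 0 < a := ENNReal.toReal_pos hpos.ne' (measure_ne_top_of_subset hsub hfin)
  have hb0 : 0 ≤ b := measureReal_nonneg
  refine le_sInf ?_
  rintro _ ⟨v, hv, hw, rfl⟩
  have hset (f : EuclideanSpace ℝ (Fin n) → ℝ) :
      ∫ x in Ω, f x * Ω₁.indicator 1 x = ∫ x in Ω₁, f x := by
    have h0 : (fun x => f x * Ω₁.indicator 1 x) = Ω₁.indicator f := by
      ext x; by_cases hx : x ∈ Ω₁ <;> simp [hx]
    rw [h0, integral_indicator₀ (hmeas.mono_ac Measure.restrict_le_self.absolutelyContinuous),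
      Measure.restrict_restrict_of_subset hsub]
  -- Testing with the characteristic function of `Ω₁` itself gives convergence of the integrals over
  -- `Ω₁`.
  have hlim := hw _ (inLp_indicator_one hmeas hfin _)
  simp only [hset] at hlim
  have hone : ∫ x in Ω₁, Ω₁.indicator (1 : EuclideanSpace ℝ (Fin n) → ℝ) x = a := by
    rw [← hset]
    have h0 : (fun x => Ω₁.indicator (1 : EuclideanSpace ℝ (Fin n) → ℝ) x * Ω₁.indicator 1 x) =
        Ω₁.indicator 1 := by
      ext x; by_cases hx : x ∈ Ω₁ <;> simp [hx]
    have := hset 1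
    simp only [Pi.one_apply, one_mul] at this
    rw [h0, this]
    simp [ha]
  rw [hone] at hlim
  have hs : Tendsto (fun j => (∫ x in Ω₁, v j x) / a) atTop (𝓝 1) := by
    simpa [ha0.ne'] using hlim.div_const a
  set δ := min (b ^ 2) (2 * (a * b)) * (1 / 4 : ℝ) ^ p with hδ
  -- Only the average `s` of `v j` over `Ω₁` converges, while `m₁ ≥ s`. Since `|2s - 1|` is not
  -- monotone in `s`, the positive part of `2s - 1` replaces it, with the same value at `s = 1`.
  have hg : Tendsto (fun j => ((a ^ 2 * (max (2 * ((∫ x in Ω₁, v j x) / a) - 1) 0) ^ p + δ : ℝ)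
      : EReal)) atTop (𝓝 ((a ^ 2 + δ : ℝ) : EReal)) := by
    apply (continuous_coe_real_ereal.tendsto _).comp
    have hc : Continuous fun s : ℝ => a ^ 2 * (max (2 * s - 1) 0) ^ p + δ := by
      have : Continuous fun s : ℝ => (max (2 * s - 1) 0) ^ p :=
        (by fun_prop : Continuous fun s : ℝ => max (2 * s - 1) 0).rpow_const
          fun _ => Or.inr (by linarith)
      fun_prop
    have := (hc.tendsto 1).comp hs
    norm_num at this
    exact this
  rw [← hg.liminf_eq]
  refine liminf_le_liminf ?_
  filter_upwards [hs.eventually (lt_mem_nhds (show (7 / 8 : ℝ) < 1 by norm_num))] with j hj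
  obtain ⟨m₁, m₀, h₁, h₀, hle⟩ := block_lower_bound hsub hmeas hfin hp.le (hv j)
  refine le_trans ?_ hle
  rw [EReal.coe_le_coe_iff, ← ha, ← hb]
  have hm : (∫ x in Ω₁, v j x) / a ≤ m₁ := by
    rw [div_le_iff₀ ha0, mul_comm]
    exact (le_abs_self _).trans h₁
  have e1 : (max (2 * ((∫ x in Ω₁, v j x) / a) - 1) 0) ^ p ≤ |2 * m₁ - 1| ^ p := by
    refine Real.rpow_le_rpow (le_max_right _ _) ?_ (by linarith)
    exact max_le ((by linarith : _ ≤ 2 * m₁ - 1).trans (le_abs_self _)) (abs_nonneg _)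
  -- If `m₁ > 7/8` and `|m₁ + m₀ - 1| < 1/4`, then `m₀ < 3/8`, hence `1 - 2 * m₀ > 1/4`.
  have e2 : δ ≤ 2 * (a * b) * |m₁ + m₀ - 1| ^ p + b ^ 2 * |2 * m₀ - 1| ^ p := by
    have hq {t : ℝ} (ht : 1 / 4 ≤ |t|) : (1 / 4 : ℝ) ^ p ≤ |t| ^ p :=
      Real.rpow_le_rpow (by norm_num) ht (by linarith)
    by_cases hc : 1 / 4 ≤ |m₁ + m₀ - 1|
    · have : δ ≤ 2 * (a * b) * |m₁ + m₀ - 1| ^ p :=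
        mul_le_mul (min_le_right _ _) (hq hc) (by positivity) (by positivity)
      have : 0 ≤ b ^ 2 * |2 * m₀ - 1| ^ p := by positivity
      linarith
    · have hc' : 1 / 4 ≤ |2 * m₀ - 1| := by
        have := (abs_lt.1 (not_le.1 hc)).2
        rw [le_abs]; right; linarith
      have : δ ≤ b ^ 2 * |2 * m₀ - 1| ^ p :=
        mul_le_mul (min_le_left _ _) (hq hc') (by positivity) (by positivity)
      have : 0 ≤ 2 * (a * b) * |m₁ + m₀ - 1| ^ p := by positivity
      linarith
  have := mul_le_mul_of_nonneg_left e1 (sq_nonneg a)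
  linarith

/-! ### Characteristic functions and the separately convex envelope -/

/-- The double integral of a two-valued function. -/
theorem functional_indicator {Ω Ω₁ : Set (EuclideanSpace ℝ (Fin n))} (hsub : Ω₁ ⊆ Ω)
    (hΩ : MeasurableSet Ω) (hmeas : NullMeasurableSet Ω₁ volume) (hfin : volume Ω ≠ ∞)
    (G : ℝ × ℝ → ℝ) :
    functional Ω G (Ω₁.indicator 1) =
      (((volume.real Ω₁) ^ 2 * G (1, 1) +
        volume.real Ω₁ * volume.real (Ω \ Ω₁) * (G (1, 0) + G (0, 1)) +
        (volume.real (Ω \ Ω₁)) ^ 2 * G (0, 0) : ℝ) : EReal) := by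
  set a := volume.real Ω₁ with ha
  set b := volume.real (Ω \ Ω₁) with hb
  have ha0 : 0 ≤ a := measureReal_nonneg
  have hb0 : 0 ≤ b := measureReal_nonneg
  have ha' : volume Ω₁ = ENNReal.ofReal a :=
    (ofReal_measureReal (measure_ne_top_of_subset hsub hfin)).symm
  have hb' : volume (Ω \ Ω₁) = ENNReal.ofReal b :=
    (ofReal_measureReal (measure_ne_top_of_subset Set.sdiff_subset hfin)).symm
  have h1 (f : ℝ → ℝ≥0∞) : ∫⁻ x in Ω₁, f (Ω₁.indicator 1 x) = f 1 * ENNReal.ofReal a := by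
    rw [← ha', ← setLIntegral_const]
    refine lintegral_congr_ae ?_
    filter_upwards [ae_restrict_mem₀ hmeas] with x hx
    simp [hx]
  have h0 (f : ℝ → ℝ≥0∞) : ∫⁻ x in Ω \ Ω₁, f (Ω₁.indicator 1 x) = f 0 * ENNReal.ofReal b := by
    rw [← hb', ← setLIntegral_const]
    refine lintegral_congr_ae ?_
    filter_upwards [ae_restrict_mem₀ (hΩ.nullMeasurableSet.diff hmeas)] with x hx
    simp [hx.2]
  have step (f : ℝ → ℝ≥0∞) : ∫⁻ x in Ω, f (Ω₁.indicator 1 x) =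
      f 1 * ENNReal.ofReal a + f 0 * ENNReal.ofReal b := by
    rw [restrict_add_restrict_sdiff hsub hmeas, lintegral_add_measure, h1, h0]
  have total (F : ℝ × ℝ → ℝ) :
      ∫⁻ y in Ω, ∫⁻ x in Ω, ENNReal.ofReal (F (Ω₁.indicator 1 x, Ω₁.indicator 1 y)) =
        ENNReal.ofReal ((max (F (1, 1)) 0 * a + max (F (0, 1)) 0 * b) * a +
          (max (F (1, 0)) 0 * a + max (F (0, 0)) 0 * b) * b) := by
    rw [lintegral_congr fun y => step fun s => ENNReal.ofReal (F (s, Ω₁.indicator 1 y)),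
      step fun t => ENNReal.ofReal (F (1, t)) * ENNReal.ofReal a +
        ENNReal.ofReal (F (0, t)) * ENNReal.ofReal b]
    have hmax (t : ℝ) : ENNReal.ofReal t = ENNReal.ofReal (max t 0) := by
      rw [ENNReal.ofReal_max]; simp
    rw [hmax (F (1, 1)), hmax (F (0, 1)), hmax (F (1, 0)), hmax (F (0, 0))]
    have hn (t : ℝ) : 0 ≤ max t 0 := le_max_right _ _
    have n1 := hn (F (1, 1)); have n2 := hn (F (0, 1))
    have n3 := hn (F (1, 0)); have n4 := hn (F (0, 0))
    rw [← ENNReal.ofReal_mul n1, ← ENNReal.ofReal_mul n2, ← ENNReal.ofReal_mul n3,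
      ← ENNReal.ofReal_mul n4, ← ENNReal.ofReal_add (by positivity) (by positivity),
      ← ENNReal.ofReal_add (by positivity) (by positivity),
      ← ENNReal.ofReal_mul (by positivity), ← ENNReal.ofReal_mul (by positivity),
      ← ENNReal.ofReal_add (by positivity) (by positivity)]
  rw [functional, total G, total fun z => -G z, EReal.coe_ennreal_ofReal, EReal.coe_ennreal_ofReal]
  have hn (t : ℝ) : 0 ≤ max t 0 := le_max_right _ _
  have pos (F : ℝ × ℝ → ℝ) : 0 ≤ (max (F (1, 1)) 0 * a + max (F (0, 1)) 0 * b) * a +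
          (max (F (1, 0)) 0 * a + max (F (0, 0)) 0 * b) * b := by
    have n1 := hn (F (1, 1)); have n2 := hn (F (0, 1))
    have n3 := hn (F (1, 0)); have n4 := hn (F (0, 0))
    positivity
  rw [max_eq_left (pos G), max_eq_left (pos fun z => -G z), ← EReal.coe_sub]
  have hd (t : ℝ) : max t 0 = t + max (-t) 0 := by
    rcases le_total t 0 with h | h
    · rw [max_eq_right h, max_eq_left (by linarith)]; ring
    · rw [max_eq_left h, max_eq_right (by linarith)]; ring
  rw [hd (G (1, 1)), hd (G (0, 1)), hd (G (1, 0)), hd (G (0, 0))]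
  congr 1
  ring

theorem scEnvelope_nonneg {W : ℝ × ℝ → ℝ} (hW : ∀ z, 0 ≤ W z) (z : ℝ × ℝ) :
    0 ≤ scEnvelope W z := by
  refine le_csSup ⟨W z, ?_⟩ ⟨0, fun ξ => ⟨convexOn_const 0 convex_univ,
    convexOn_const 0 convex_univ⟩, hW, rfl⟩
  rintro _ ⟨V, -, hV, rfl⟩
  exact hV z

theorem scEnvelope_le {W : ℝ × ℝ → ℝ} (hW : ∀ z, 0 ≤ W z) {z : ℝ × ℝ} {c : ℝ}
    (h : ∀ V, SeparatelyConvex V → (∀ w, V w ≤ W w) → V z ≤ c) : scEnvelope W z ≤ c := by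
  refine csSup_le ⟨0, 0, fun ξ => ⟨convexOn_const 0 convex_univ, convexOn_const 0 convex_univ⟩,
    hW, rfl⟩ ?_
  rintro _ ⟨V, hV, hVW, rfl⟩
  exact h V hV hVW

theorem scEnvelope_integrand_values {p : ℝ} (hp : 0 < p) :
    scEnvelope (integrand p) (1, 1) ≤ 1 ∧ scEnvelope (integrand p) (1, 0) ≤ 0 ∧
      scEnvelope (integrand p) (0, 1) ≤ 0 ∧ scEnvelope (integrand p) (0, 0) ≤ 0 := by
  have hW := integrand_nonneg p
  have v1 : integrand p (1, 1) = 1 := by rw [integrand_eq]; norm_num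
  have v2 : integrand p (1, 0) = 0 := by rw [integrand_eq]; simp [hp.ne']
  have v3 : integrand p (0, 1) = 0 := by rw [integrand_eq]; simp [hp.ne']
  have v4 : integrand p (0, -1) = 0 := by rw [integrand_eq]; simp [hp.ne']
  refine ⟨scEnvelope_le hW fun V _ h => (h _).trans_eq v1, scEnvelope_le hW fun V _ h => (h _).trans_eq v2,
    scEnvelope_le hW fun V _ h => (h _).trans_eq v3, scEnvelope_le hW fun V hV h => ?_⟩
  have h3 := (h (0, 1)).trans_eq v3
  have h4 := (h (0, -1)).trans_eq v4
  obtain ⟨-, hconv⟩ := (hV 0).2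
  -- The origin is the midpoint of `(0, 1)` and `(0, -1)`, two zeros of the integrand on a line
  -- parallel to an axis.
  have := hconv (Set.mem_univ 1) (Set.mem_univ (-1)) (a := 1 / 2) (b := 1 / 2)
    (by norm_num) (by norm_num) (by norm_num)
  norm_num at this
  linarith

/-! ### Square waves and the relaxation at zero -/

/-- The square wave with values `±1/2` and half-period `1 / (j + 1)` in the coordinate `i`. -/
noncomputable def squareWave (i : Fin n) (j : ℕ) (x : EuclideanSpace ℝ (Fin n)) : ℝ :=
  if Even ⌊((j : ℝ) + 1) * x i⌋ then 1 / 2 else -(1 / 2)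

theorem abs_squareWave (i : Fin n) (j : ℕ) (x : EuclideanSpace ℝ (Fin n)) :
    |squareWave i j x| = 1 / 2 := by
  unfold squareWave; split_ifs <;> norm_num

theorem measurable_squareWave (i : Fin n) (j : ℕ) : Measurable (squareWave i j) := by
  have h : Measurable fun x : EuclideanSpace ℝ (Fin n) => ⌊((j : ℝ) + 1) * x i⌋ := by
    apply Int.measurable_floor.comp
    fun_prop
  exact Measurable.ite (h (MeasurableSet.of_discrete (s := {k : ℤ | Even k})))
    measurable_const measurable_const

theorem squareWave_add (i : Fin n) (j : ℕ) (x : EuclideanSpace ℝ (Fin n)) :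
    squareWave i j (x + EuclideanSpace.single i (1 / ((j : ℝ) + 1))) = -squareWave i j x := by
  have hj : (j : ℝ) + 1 ≠ 0 := by positivity
  have h : ((j : ℝ) + 1) * (x + EuclideanSpace.single i (1 / ((j : ℝ) + 1))) i =
      ((j : ℝ) + 1) * x i + 1 := by
    simp [mul_add, hj]
  unfold squareWave
  rw [h, Int.floor_add_one]
  by_cases he : Even ⌊((j : ℝ) + 1) * x i⌋
  · simp [he]
  · simp [he]

theorem integrable_squareWave_mul (i : Fin n) (j : ℕ) {h : EuclideanSpace ℝ (Fin n) → ℝ}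
    (hh : Integrable h) : Integrable fun x => squareWave i j x * h x :=
  hh.bdd_mul (c := 1 / 2) (measurable_squareWave i j).aestronglyMeasurable
    (ae_of_all _ fun x => (abs_squareWave i j x).le)

/-- Translation by the half-period `e j` flips the sign of the wave, so the integral equals half the
integral of the wave against `h x - h (x + e j)`. This difference tends to zero pointwise, and
dominated convergence applies. -/
theorem tendsto_integral_squareWave_mul_of_hasCompactSupport (i : Fin n)
    {h : EuclideanSpace ℝ (Fin n) → ℝ} (hc : Continuous h) (hs : HasCompactSupport h) :
    Tendsto (fun j => ∫ x, squareWave i j x * h x) atTop (𝓝 0) := by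
  have hint : Integrable h := hc.integrable_of_hasCompactSupport hs
  let e : ℕ → EuclideanSpace ℝ (Fin n) := fun j => EuclideanSpace.single i (1 / ((j : ℝ) + 1))
  have he : Tendsto e atTop (𝓝 0) := by
    rw [tendsto_zero_iff_norm_tendsto_zero]
    have h0 := tendsto_one_div_add_atTop_nhds_zero_nat (𝕜 := ℝ)
    refine h0.congr fun j => ?_
    have : (0 : ℝ) < (j : ℝ) + 1 := by positivity
    simp [e, abs_of_pos this]
  have hshift (j : ℕ) : ∫ x, squareWave i j x * h x =
      ∫ x, (1 / 2) * (squareWave i j x * (h x - h (x + e j))) := by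
    have h1 : ∫ x, squareWave i j x * h x = -∫ x, squareWave i j x * h (x + e j) := by
      rw [← integral_add_right_eq_self (fun x => squareWave i j x * h x) (e j), ← integral_neg]
      congr 1
      ext x
      rw [squareWave_add]
      ring
    rw [integral_const_mul]
    simp only [mul_sub]
    rw [integral_sub (integrable_squareWave_mul i j hint)
      (integrable_squareWave_mul i j (hint.comp_add_right (e j)))]
    linarith
  simp only [hshift]
  obtain ⟨C, hC⟩ := hs.exists_bound_of_continuous hc
  have hC0 : 0 ≤ C := (norm_nonneg _).trans (hC 0)
  obtain ⟨R, hR⟩ := hs.isCompact.isBounded.subset_closedBall 0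
  have hzero (x : EuclideanSpace ℝ (Fin n)) (hx : R < ‖x‖) : h x = 0 := by
    by_contra hne
    have := hR (subset_tsupport h hne)
    rw [mem_closedBall_zero_iff] at this
    linarith
  have henorm (j : ℕ) : ‖e j‖ ≤ 1 := by
    have : (0 : ℝ) < (j : ℝ) + 1 := by positivity
    have h2 : ((j : ℝ) + 1)⁻¹ ≤ 1 := inv_le_one_of_one_le₀ (by linarith [Nat.cast_nonneg (α := ℝ) j])
    simpa [e, abs_of_pos this] using h2
  rw [← integral_zero (EuclideanSpace ℝ (Fin n)) ℝ (μ := volume)]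
  -- As `‖e j‖ ≤ 1`, both `h` and its translate vanish outside the ball of radius `R + 1`.
  refine tendsto_integral_of_dominated_convergence
    ((Metric.closedBall 0 (R + 1)).indicator fun _ => C) (fun j => ?_) ?_ (fun j => ?_) ?_
  · have : Continuous fun x => h x - h (x + e j) := by fun_prop
    exact (((measurable_squareWave i j).mul this.measurable).const_mul _).aestronglyMeasurable
  · exact (integrable_indicator_iff Metric.isClosed_closedBall.measurableSet).2
      (integrableOn_const (isCompact_closedBall _ _).measure_lt_top.ne)
  · refine ae_of_all _ fun x => ?_
    by_cases hx : x ∈ Metric.closedBall (0 : EuclideanSpace ℝ (Fin n)) (R + 1)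
    · rw [Set.indicator_of_mem hx, norm_mul, norm_mul, Real.norm_eq_abs (squareWave i j x),
        abs_squareWave]
      have := (norm_sub_le (h x) (h (x + e j))).trans (add_le_add (hC _) (hC _))
      rw [Real.norm_eq_abs] at this ⊢
      norm_num
      linarith
    · rw [mem_closedBall_zero_iff, not_le] at hx
      have h1 : ‖x‖ ≤ ‖x + e j‖ + ‖e j‖ := by
        simpa using norm_sub_le (x + e j) (e j)
      have h2 := henorm j
      rw [hzero x (by linarith), hzero (x + e j) (by linarith)]
      simpa using Set.indicator_nonneg (fun _ _ => hC0) x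
  · refine ae_of_all _ fun x => ?_
    have hlim : Tendsto (fun j => h x - h (x + e j)) atTop (𝓝 0) := by
      have h1 : Tendsto (fun j => x + e j) atTop (𝓝 x) := by
        simpa using (tendsto_const_nhds (x := x)).add he
      simpa using (tendsto_const_nhds (x := h x)).sub ((hc.tendsto x).comp h1)
    refine squeeze_zero_norm (fun j => ?_) (by simpa using hlim.norm)
    rw [norm_mul, norm_mul, Real.norm_eq_abs (squareWave i j x), abs_squareWave]
    have := norm_nonneg (h x - h (x + e j))
    rw [Real.norm_eq_abs] at this ⊢
    norm_num
    linarith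

/-- A Riemann-Lebesgue lemma for square waves. -/
theorem tendsto_integral_squareWave_mul (i : Fin n) {g : EuclideanSpace ℝ (Fin n) → ℝ}
    (hg : Integrable g) : Tendsto (fun j => ∫ x, squareWave i j x * g x) atTop (𝓝 0) := by
  rw [Metric.tendsto_atTop]
  intro ε hε
  obtain ⟨h, hs, hgh, hc, hint⟩ := hg.exists_hasCompactSupport_integral_sub_le (half_pos hε)
  obtain ⟨N, hN⟩ := Metric.tendsto_atTop.1
    (tendsto_integral_squareWave_mul_of_hasCompactSupport i hc hs) (ε / 2) (half_pos hε)
  refine ⟨N, fun j hj => ?_⟩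
  have h1 := hN j hj
  rw [dist_zero_right] at h1 ⊢
  have h2 : ‖∫ x, squareWave i j x * (g x - h x)‖ ≤ ε / 2 := by
    refine (norm_integral_le_integral_norm _).trans (le_trans ?_ hgh)
    refine integral_mono (integrable_squareWave_mul i j (hg.sub hint)).norm
      (hg.sub hint).norm fun x => ?_
    simp only [norm_mul, Real.norm_eq_abs (squareWave i j x), abs_squareWave]
    have := norm_nonneg (g x - h x)
    linarith
  have h3 : ∫ x, squareWave i j x * g x =
      (∫ x, squareWave i j x * (g x - h x)) + ∫ x, squareWave i j x * h x := by
    simp only [mul_sub]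
    rw [integral_sub (integrable_squareWave_mul i j hg) (integrable_squareWave_mul i j hint)]
    ring
  rw [h3]
  linarith [norm_add_le (∫ x, squareWave i j x * (g x - h x)) (∫ x, squareWave i j x * h x)]

/-- Square waves tend weakly to zero, while every pair of their values `±1/2` lies on `sphere₁`, so
their functional vanishes. -/
theorem relaxation_zero_le (i : Fin n) {Ω : Set (EuclideanSpace ℝ (Fin n))}
    (hΩ : MeasurableSet Ω) (hfin : volume Ω ≠ ∞) {p : ℝ} (hp : 1 < p) :
    relaxation p Ω (integrand p) 0 ≤ 0 := by
  have : IsFiniteMeasure (volume.restrict Ω) := isFiniteMeasure_restrict.2 hfin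
  refine sInf_le ⟨squareWave i, fun j => ?_, fun g hg => ?_, ?_⟩
  · exact MemLp.of_bound (measurable_squareWave i j).aestronglyMeasurable (1 / 2)
      (ae_of_all _ fun x => (abs_squareWave i j x).le)
  · have hq : 1 ≤ p / (p - 1) := by
      rw [le_div_iff₀ (by linarith)]; linarith
    have hg1 : Integrable g (volume.restrict Ω) :=
      memLp_one_iff_integrable.1 (MemLp.mono_exponent hg (by simpa using hq))
    have := tendsto_integral_squareWave_mul i ((integrable_indicator_iff hΩ).2 hg1)
    simp only [Pi.zero_apply, zero_mul, integral_zero]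
    refine this.congr fun j => ?_
    rw [← integral_indicator hΩ]
    congr 1
    ext x
    by_cases hx : x ∈ Ω <;> simp [hx]
  · have h0 (j : ℕ) : functional Ω (integrand p) (squareWave i j) = 0 := by
      rw [functional_of_nonneg Ω (integrand_nonneg p)]
      have (x y : EuclideanSpace ℝ (Fin n)) :
          integrand p (squareWave i j x, squareWave i j y) = 0 := by
        rw [integrand_eq]
        simp only [abs_squareWave]
        norm_num
        exact Real.zero_rpow (by linarith)
      simp [this]
    simp [h0]

/-! ### The two contradictions -/

theorem relaxation_le_functional {Ω : Set (EuclideanSpace ℝ (Fin n))} {p : ℝ} (W : ℝ × ℝ → ℝ)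
    {u : EuclideanSpace ℝ (Fin n) → ℝ} (hu : InLp p Ω u) :
    relaxation p Ω W u ≤ functional Ω W u :=
  sInf_le ⟨fun _ => u, fun _ => hu, fun _ _ => tendsto_const_nhds, by simp⟩

/-- In positive dimension a point is a null set, so outer regularity gives it neighbourhoods of
arbitrarily small volume. -/
theorem exists_isOpen_subset_volume_lt (hn : 1 ≤ n) {Ω : Set (EuclideanSpace ℝ (Fin n))}
    (hne : Ω.Nonempty) (hopen : IsOpen Ω) {ε : ℝ} (hε : 0 < ε) :
    ∃ U ⊆ Ω, IsOpen U ∧ 0 < volume U ∧ volume U < ENNReal.ofReal ε := by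
  obtain ⟨x, hx⟩ := hne
  have : Nonempty (Fin n) := ⟨⟨0, hn⟩⟩
  have : Nontrivial (EuclideanSpace ℝ (Fin n)) := inferInstance
  obtain ⟨V, hxV, hV, hlt⟩ := Set.exists_isOpen_lt_of_lt (μ := volume) {x} (ENNReal.ofReal ε)
    (by simpa using hε)
  exact ⟨Ω ∩ V, Set.inter_subset_left, hopen.inter hV,
    (hopen.inter hV).measure_pos _ ⟨x, hx, hxV rfl⟩,
    (measure_mono Set.inter_subset_right).trans_lt hlt⟩

theorem relaxation_ne_functional_scEnvelope {Ω Ω₁ : Set (EuclideanSpace ℝ (Fin n))}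
    (hΩ : MeasurableSet Ω) (hfin : volume Ω ≠ ∞) {p : ℝ} (hp : 1 < p) (hsub : Ω₁ ⊆ Ω)
    (hmeas : NullMeasurableSet Ω₁ volume) (hpos : 0 < volume Ω₁) (hpos' : 0 < volume (Ω \ Ω₁)) :
    relaxation p Ω (integrand p) (Ω₁.indicator 1) ≠
      functional Ω (scEnvelope (integrand p)) (Ω₁.indicator 1) := by
  have hlow := relaxation_indicator_lower_bound hsub hmeas hfin hp hpos
  intro heq
  rw [heq, functional_indicator hsub hΩ hmeas hfin, EReal.coe_le_coe_iff] at hlow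
  have ha : 0 < volume.real Ω₁ :=
    ENNReal.toReal_pos hpos.ne' (measure_ne_top_of_subset hsub hfin)
  have hb : 0 < volume.real (Ω \ Ω₁) :=
    ENNReal.toReal_pos hpos'.ne' (measure_ne_top_of_subset Set.sdiff_subset hfin)
  obtain ⟨v1, v2, v3, v4⟩ := scEnvelope_integrand_values (p := p) (by linarith)
  set a := volume.real Ω₁
  set b := volume.real (Ω \ Ω₁)
  have hδ : 0 < min (b ^ 2) (2 * (a * b)) * (1 / 4 : ℝ) ^ p := by positivity
  have e1 := mul_le_mul_of_nonneg_left v1 (sq_nonneg a)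
  have e2 := mul_le_mul_of_nonneg_left (add_le_add v2 v3) (mul_pos ha hb).le
  have e3 := mul_le_mul_of_nonneg_left v4 (sq_nonneg b)
  linarith

theorem not_exists_relaxation_eq_functional (hn : 1 ≤ n)
    {Ω : Set (EuclideanSpace ℝ (Fin n))} (hne : Ω.Nonempty) (hopen : IsOpen Ω)
    (hfin : volume Ω ≠ ∞) {p : ℝ} (hp : 1 < p) (G : ℝ × ℝ → ℝ) :
    ¬ ∀ u, InLp p Ω u → relaxation p Ω (integrand p) u = functional Ω G u := by
  intro hG
  have hΩ := hopen.measurableSet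
  have hMpos : 0 < volume Ω := hopen.measure_pos _ hne
  set M := volume.real Ω with hM
  have hM0 : 0 < M := ENNReal.toReal_pos hMpos.ne' hfin
  have val {U : Set (EuclideanSpace ℝ (Fin n))} (hU : U ⊆ Ω) (hm : MeasurableSet U) :=
    (hG _ (inLp_indicator_one hm.nullMeasurableSet hfin p)).trans
      (functional_indicator hU hΩ hm.nullMeasurableSet hfin G)
  have upper {U : Set (EuclideanSpace ℝ (Fin n))} (hU : U ⊆ Ω) (hm : MeasurableSet U) :=
    (relaxation_le_functional (integrand p)
      (inLp_indicator_one hm.nullMeasurableSet hfin p)).trans_eq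
      (functional_indicator hU hΩ hm.nullMeasurableSet hfin (integrand p))
  have v1 : integrand p (1, 1) = 1 := by rw [integrand_eq]; norm_num
  have v2 : integrand p (1, 0) = 0 := by rw [integrand_eq]; simp [(zero_lt_one.trans hp).ne']
  have v3 : integrand p (0, 1) = 0 := by rw [integrand_eq]; simp [(zero_lt_one.trans hp).ne']
  have v4 : integrand p (0, 0) = 1 := by rw [integrand_eq]; simp
  have g00 : G (0, 0) ≤ 0 := by
    have h := relaxation_zero_le ⟨0, hn⟩ hΩ hfin hp
    -- The zero function is the characteristic function of the empty set.
    have h' := val (Set.empty_subset Ω) MeasurableSet.empty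
    rw [Set.indicator_empty] at h'
    have h'' := h'.symm.trans_le h
    rw [← EReal.coe_zero, EReal.coe_le_coe_iff] at h''
    simp only [Set.sdiff_empty, measureReal_empty, ← hM] at h''
    by_contra hc
    have := mul_pos (pow_pos hM0 2) (not_le.1 hc)
    linarith
  have g11 : G (1, 1) = 1 := by
    -- With `Ω₁ = Ω` the gap vanishes, and the lower and upper bounds both equal `M ^ 2`.
    have h := relaxation_indicator_lower_bound subset_rfl hΩ.nullMeasurableSet hfin hp hMpos
    have h' := upper subset_rfl hΩ
    rw [val subset_rfl hΩ, EReal.coe_le_coe_iff] at h h'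
    simp only [Set.sdiff_self, measureReal_empty, ← hM, v1] at h h'
    norm_num at h h'
    have hsq := pow_pos hM0 2
    apply le_antisymm
    · exact le_of_mul_le_mul_left (by linarith) hsq
    · exact le_of_mul_le_mul_left (by linarith) hsq
  have main {U : Set (EuclideanSpace ℝ (Fin n))} (hU : U ⊆ Ω) (hm : MeasurableSet U)
      (hpos : 0 < volume U) (hlt : volume U < volume Ω) :
      0 < G (1, 0) + G (0, 1) ∧
        (M - volume.real U) * (G (1, 0) + G (0, 1)) ≤ volume.real U * (1 - G (0, 0)) := by
    have hb : 0 < volume.real U :=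
      ENNReal.toReal_pos hpos.ne' (measure_ne_top_of_subset hU hfin)
    have ha' : volume.real (Ω \ U) = M - volume.real U :=
      measureReal_sdiff hU hm hfin
    have hbM : volume.real U < M := (ENNReal.toReal_lt_toReal
      (measure_ne_top_of_subset hU hfin) hfin).2 hlt
    have hposa : 0 < volume (Ω \ U) := by
      by_contra h0
      have : volume.real (Ω \ U) = 0 := by
        rw [measureReal_def, nonpos_iff_eq_zero.1 (not_lt.1 h0)]; rfl
      linarith
    -- The small set `U` is where the function vanishes; its complement carries the value `1`.
    have hlow := relaxation_indicator_lower_bound (Ω₁ := Ω \ U) Set.sdiff_subset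
      (hΩ.diff hm).nullMeasurableSet hfin hp hposa
    have hup := upper (U := Ω \ U) Set.sdiff_subset (hΩ.diff hm)
    rw [val Set.sdiff_subset (hΩ.diff hm), EReal.coe_le_coe_iff] at hlow hup
    rw [Set.sdiff_sdiff_cancel_left hU, ha', g11] at hlow hup
    rw [v1, v2, v3, v4] at hup
    set b := volume.real U
    have ha : 0 < M - b := by linarith
    have hδ : 0 < min (b ^ 2) (2 * ((M - b) * b)) * (1 / 4 : ℝ) ^ p := by positivity
    have e3 := mul_le_mul_of_nonneg_left g00 (sq_nonneg b)
    constructor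
    · have : 0 < (M - b) * b * (G (1, 0) + G (0, 1)) := by linarith
      exact pos_of_mul_pos_right this (by positivity)
    · refine le_of_mul_le_mul_left ?_ hb
      linarith
  obtain ⟨U, hU, hUo, hUpos, hUlt⟩ := exists_isOpen_subset_volume_lt hn hne hopen hM0
  rw [hM, ofReal_measureReal hfin] at hUlt
  have hg := (main hU hUo.measurableSet hUpos hUlt).1
  set g := G (1, 0) + G (0, 1)
  have hD : 0 < 1 - G (0, 0) + g := by linarith
  -- Since `g` depends on `G` alone, `V` may be chosen after it. The second inequality of `main`
  -- rearranges to `M * g ≤ b * (1 - G (0, 0) + g)` with `b = |V|`, which the second bound in the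
  -- minimum contradicts.
  obtain ⟨V, hV, hVo, hVpos, hVlt⟩ := exists_isOpen_subset_volume_lt hn hne hopen
    (ε := min M (M * g / (1 - G (0, 0) + g))) (by positivity)
  have hVM : volume V < volume Ω := by
    refine hVlt.trans_le ?_
    rw [← ofReal_measureReal hfin]
    exact ENNReal.ofReal_le_ofReal (min_le_left _ _)
  have h2 := (main hV hVo.measurableSet hVpos hVM).2
  have h3 : volume.real V < M * g / (1 - G (0, 0) + g) := by
    refine lt_of_lt_of_le ?_ (min_le_right M _)
    exact (ENNReal.lt_ofReal_iff_toReal_lt (measure_ne_top_of_subset hV hfin)).1 hVlt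
  rw [lt_div_iff₀ hD] at h3
  linarith

end DoubleIntegral

theorem proposition4p3 (n : ℕ) (hn : 1 ≤ n) (Ω : Set (EuclideanSpace ℝ (Fin n)))
    (hΩ_ne : Ω.Nonempty) (hΩ_open : IsOpen Ω) (hΩ_bdd : Bornology.IsBounded Ω)
    (p : ℝ) (hp : 1 < p) :
    (¬ ∃ G : ℝ × ℝ → ℝ,
      DoubleIntegral.IsSymm G ∧ LowerSemicontinuous G ∧ DoubleIntegral.HasGrowth p G ∧
        ∀ u : EuclideanSpace ℝ (Fin n) → ℝ, DoubleIntegral.InLp p Ω u →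
          DoubleIntegral.relaxation p Ω (DoubleIntegral.integrand p) u =
            DoubleIntegral.functional Ω G u) ∧
    (∀ Ω₁ : Set (EuclideanSpace ℝ (Fin n)), Ω₁ ⊆ Ω → NullMeasurableSet Ω₁ volume →
      0 < volume Ω₁ → 0 < volume (Ω \ Ω₁) →
        DoubleIntegral.relaxation p Ω (DoubleIntegral.integrand p) (Ω₁.indicator 1) ≠
          DoubleIntegral.functional Ω
            (DoubleIntegral.scEnvelope (DoubleIntegral.integrand p)) (Ω₁.indicator 1)) := by
  have hfin : volume Ω ≠ ∞ := hΩ_bdd.measure_lt_top.ne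
  refine ⟨?_, fun Ω₁ hsub hmeas hpos hpos' => ?_⟩
  · rintro ⟨G, -, -, -, hG⟩
    exact DoubleIntegral.not_exists_relaxation_eq_functional hn hΩ_ne hΩ_open hfin hp G hG
  · exact DoubleIntegral.relaxation_ne_functional_scEnvelope hΩ_open.measurableSet hfin hp hsub
      hmeas hpos hpos'
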